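/- A binary tree is either a leaf or a node with a left and a right subtree; its size is its number of nodes. A right rotation replaces, at some node, a subtree of the form $((T_1,T_2),T_3)$ by $(T_1,(T_2,T_3))$. The Tamari order $\le$ on binary trees of size $n$ is the reflexive and transitive closure of right rotation, and a Tamari interval of size $n\ge 1$ is a pair $(T,T')$ of binary trees of size $n$ with $T\le T'$. A leaf has type $1$ if it is the left child of its parent and type $0$ if it is the right child, and the canopy-vector of a tree of size $n$ is the word in $\{0,1\}^{n+1}$ of the types of its leaves from left to right. A canopy-entry of $(T,T')$ of type ${p \brack q}$ is a position at which the canopy-vector of $T'$ has entry $p$ and that of $T$ has entry $q$. Let $I_{i,j,m}$ be the number of Tamari intervals of size $n=i+j+m-1\ge 1$ with $i$, $j$, $m$ canopy-entries of type ${1\brack 1}$, ${0\brack 0}$, ${1\brack 0}$ respectively. **Proposition.** There is a unique pair of formal power series $A,B\in\mathbb{Q}[[x,y,z]]$ such that $1-A$ and $1-B$ are invertible and $$A=\frac{1}{(1-B)^2}\left(y+\frac{zA}{1-A}\right),\qquad B=\frac{1}{(1-A)^2}\left(x+\frac{zB}{1-B}\right),$$ and for these series $$\sum_{i,j,m\ge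 0}(i+j+m-1)\,I_{i,j,m}\,x^iy^jz^m=AB,$$ $$\sum_{i,j,m\ge 0}I_{i,j,m}\,x^iy^jz^m=\frac{xA}{1-A}+\frac{yB}{1-B}+\frac{zAB}{(1-A)(1-B)}-AB.$$ -/

import Mathlib

namespace TamariCanopy

/-- Right rotation at one node: `RightRotation T T'` says that `T'` is obtained from `T` by
replacing, for some node `u` of `T`, the subtree `((a, b), c)` of `T` rooted at `u` by
`(a, (b, c))`. Binary trees are Mathlib's `BinaryTree Unit`, where `nil` is a leaf and
`node () l r` is a binary node with left subtree `l` and right subtree `r`. -/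
inductive RightRotation : BinaryTree Unit → BinaryTree Unit → Prop
  | root (a b c : BinaryTree Unit) :
      RightRotation (.node () (.node () a b) c) (.node () a (.node () b c))
  | left {l l' : BinaryTree Unit} (r : BinaryTree Unit) (h : RightRotation l l') :
      RightRotation (.node () l r) (.node () l' r)
  | right (l : BinaryTree Unit) {r r' : BinaryTree Unit} (h : RightRotation r r') :
      RightRotation (.node () l r) (.node () l r')

/-- The Tamari order: the reflexive transitive closure of right rotation. -/
def TamariLE (T T' : BinaryTree Unit) : Prop :=
  Relation.ReflTransGen RightRotation T T'

/-- The set of Tamari intervals of size `n`, i.e. of pairs `(T, T')` of binary trees with `n`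
nodes such that `T ≤ T'` in the Tamari order. -/
def tamariIntervals (n : ℕ) : Set (BinaryTree Unit × BinaryTree Unit) :=
  {I | I.1.numNodes = n ∧ I.2.numNodes = n ∧ TamariLE I.1 I.2}

/-- The list of the types of the leaves of a tree, from left to right, when the tree hangs as
a subtree whose root is a left child (`side = true`) or a right child (`side = false`) of its
parent. The type `1` (left child) is `true`, the type `0` (right child) is `false`. -/
def leafTypes (side : Bool) : BinaryTree Unit → List Bool
  | .nil => [side]
  | .node _ l r => leafTypes true l ++ leafTypes false r

/-- The canopy-vector of a binary tree, i.e. the word of the types of its leaves from left to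
right. The leaf of the tree without nodes has no parent, hence no type. -/
def canopy : BinaryTree Unit → List Bool
  | .nil => []
  | .node _ l r => leafTypes true l ++ leafTypes false r

/-- The number of canopy-entries of type `[p; q]` in the pair `I = (T, T')`: the number of
positions at which the canopy-vector of the upper tree `T'` has the entry `p` and that of the
lower tree `T` has the entry `q`. -/
def canopyCount (p q : Bool) (I : BinaryTree Unit × BinaryTree Unit) : ℕ :=
  ((canopy I.2).zip (canopy I.1)).count (p, q)

/-- The set of Tamari intervals of size `n = i + j + m - 1`, where `n ≥ 1`, with `i`, `j`, `m`
canopy-entries of type `[1; 1]`, `[0; 0]`, `[1; 0]` respectively. -/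
def intervalsByCanopy (i j m : ℕ) : Set (BinaryTree Unit × BinaryTree Unit) :=
  {I | ∃ n : ℕ, 1 ≤ n ∧ n + 1 = i + j + m ∧ I ∈ tamariIntervals n ∧
    canopyCount true true I = i ∧ canopyCount false false I = j ∧ canopyCount true false I = m}

/-- The set that is counted is finite, so that its `Set.ncard` is its number of elements. -/
theorem intervalsByCanopy_finite (i j m : ℕ) : (intervalsByCanopy i j m).Finite := by
  refine ((BinaryTree.treesOfNumNodesEq (i + j + m - 1) ×ˢ
    BinaryTree.treesOfNumNodesEq (i + j + m - 1)).finite_toSet).subset ?_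
  rintro ⟨T, T'⟩ ⟨n, -, hn, ⟨h1, h2, -⟩, -⟩
  have hn' : n = i + j + m - 1 := by omega
  subst hn'
  simp only [Finset.coe_product, Set.mem_prod, Finset.mem_coe,
    BinaryTree.mem_treesOfNumNodesEq]
  exact ⟨h1, h2⟩

/-- The number `I_{i,j,m}` of such intervals. -/
noncomputable def numIntervals (i j m : ℕ) : ℕ := (intervalsByCanopy i j m).ncard

/-- Formal power series in `x`, `y`, `z` with rational coefficients. -/
abbrev Series : Type := MvPowerSeries (Fin 3) ℚ

noncomputable def x : Series := MvPowerSeries.X 0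
noncomputable def y : Series := MvPowerSeries.X 1
noncomputable def z : Series := MvPowerSeries.X 2

/-- The series `∑ I_{i,j,m} x^i y^j z^m`. -/
noncomputable def intervalSeries : Series :=
  fun d => (numIntervals (d 0) (d 1) (d 2) : ℚ)

/-- The series `∑ (i + j + m - 1) I_{i,j,m} x^i y^j z^m`. -/
noncomputable def markedIntervalSeries : Series :=
  fun d => ((d 0 : ℚ) + (d 1 : ℚ) + (d 2 : ℚ) - 1) * (numIntervals (d 0) (d 1) (d 2) : ℚ)

theorem coeff_intervalSeries (d : Fin 3 →₀ ℕ) :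
    MvPowerSeries.coeff d intervalSeries = (numIntervals (d 0) (d 1) (d 2) : ℚ) := rfl

theorem coeff_markedIntervalSeries (d : Fin 3 →₀ ℕ) :
    MvPowerSeries.coeff d markedIntervalSeries =
      ((d 0 : ℚ) + (d 1 : ℚ) + (d 2 : ℚ) - 1) * (numIntervals (d 0) (d 1) (d 2) : ℚ) := rfl

/-- The system of equations that defines the pair `(A, B)`. The first two conditions say that
the denominators are invertible, so that `⁻¹` below is the true inverse. -/
def IsCanopySystem (A B : Series) : Prop :=
  IsUnit (1 - A) ∧ IsUnit (1 - B) ∧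
  A = ((1 - B) ^ 2)⁻¹ * (y + z * A * (1 - A)⁻¹) ∧
  B = ((1 - A) ^ 2)⁻¹ * (x + z * B * (1 - B)⁻¹)

end TamariCanopy

/-! The proof derives a functional equation with one catalytic variable and solves it by the kernel
method. A tree lies below `node l r` exactly when it arises from some `L ≤ l` and `S ≤ r` by hanging
`L` on the left spine of `S` (`mem_lowerTrees`), and it arises so only once. `map_insertions` tracks
the canopy and the left spine through this step. Let `F(u)` count intervals by canopy weight, with
`u` marking the left spine of the lower tree, the first canopy-entry being omitted and the leaf
contributing `1`. Then, with `u = 1 + V`, `V (F - 1) = (1 + V) F (V (y - z) + x (F - F(1)) + V z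
F)`, where `x (F(1) - 1)` is the interval series.

Choose `V` so that the derivative of this equation in `F` vanishes (`exists_kernel`). The derivative
in `u` then gives one more relation between `V`, `W = F(1 + V)` and `F(1)`. With `A = 1 - 1/W` and
`B = V/(1 + V)` these relations become the system and the formula for the interval series.
Everything is done with polynomials in `u` truncated by size, modulo series of order above `N`; as
the system is a contraction, an approximate solution agrees with the exact one to the same order.

The marked series follows since the system says that the formula is stationary in `A` and in `B`. -/

open Polynomial

namespace TamariCanopy

/-! ### Recursive description of the trees below a given tree -/

/-- The trees obtained from `S` by replacing a subtree `S₀` on its left spine (a leaf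
allowed) by the tree with left subtree `L` and right subtree `S₀`. -/
def insertions (L : BinaryTree Unit) : BinaryTree Unit → List (BinaryTree Unit)
  | .nil => [.node () L .nil]
  | .node _ s c => .node () L (.node () s c) :: (insertions L s).map (fun t => .node () t c)

/-- The list of the trees below a given tree in the Tamari order. -/
def lowerTrees : BinaryTree Unit → List (BinaryTree Unit)
  | .nil => [.nil]
  | .node _ l r => (lowerTrees l).flatMap fun L => (lowerTrees r).flatMap fun S => insertions L S

/-- The number of nodes on the left spine of a tree. -/
def spine : BinaryTree Unit → ℕ
  | .nil => 0
  | .node _ l _ => spine l + 1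

theorem numNodes_of_mem_insertions {L S T : BinaryTree Unit} (h : T ∈ insertions L S) :
    T.numNodes = L.numNodes + S.numNodes + 1 := by
  induction S generalizing T with
  | nil => simp [insertions] at h; simp [h, BinaryTree.numNodes]
  | node _ s c ihs _ =>
    simp only [insertions, List.mem_cons, List.mem_map] at h
    rcases h with rfl | ⟨t, ht, rfl⟩
    · simp [BinaryTree.numNodes]
    · simp only [BinaryTree.numNodes, ihs ht]; omega

theorem numNodes_of_mem_lowerTrees {T T' : BinaryTree Unit} (h : T ∈ lowerTrees T') :
    T.numNodes = T'.numNodes := by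
  induction T' generalizing T with
  | nil => simp [lowerTrees] at h; simp [h]
  | node _ l r ihl ihr =>
    simp only [lowerTrees, List.mem_flatMap] at h
    obtain ⟨L, hL, S, hS, h⟩ := h
    rw [numNodes_of_mem_insertions h, ihl hL, ihr hS, BinaryTree.numNodes]

theorem head_mem_insertions (L S : BinaryTree Unit) : .node () L S ∈ insertions L S := by
  cases S <;> simp [insertions]

theorem map_mem_insertions {L s t : BinaryTree Unit} (c : BinaryTree Unit)
    (h : t ∈ insertions L s) : .node () t c ∈ insertions L (.node () s c) := by
  simp only [insertions, List.mem_cons, List.mem_map]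
  exact Or.inr ⟨t, h, rfl⟩

theorem TamariLE.node {l l' r r' : BinaryTree Unit} (hl : TamariLE l l') (hr : TamariLE r r') :
    TamariLE (.node () l r) (.node () l' r') :=
  Relation.ReflTransGen.trans
    (Relation.ReflTransGen.lift (fun t => BinaryTree.node () t r)
      (fun _ _ h => RightRotation.left r h) _ _ hl)
    (Relation.ReflTransGen.lift (fun t => BinaryTree.node () l' t)
      (fun _ _ h => RightRotation.right l' h) _ _ hr)

theorem tamariLE_of_mem_insertions {L S T : BinaryTree Unit} (h : T ∈ insertions L S) :
    TamariLE T (.node () L S) := by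
  induction S generalizing T with
  | nil => simp [insertions] at h; subst h; exact .refl
  | node _ s c ihs _ =>
    simp only [insertions, List.mem_cons, List.mem_map] at h
    rcases h with rfl | ⟨t, ht, rfl⟩
    · exact .refl
    · exact (TamariLE.node (ihs ht) .refl).tail (.root L s c)

theorem tamariLE_of_mem_lowerTrees {T T' : BinaryTree Unit} (h : T ∈ lowerTrees T') :
    TamariLE T T' := by
  induction T' generalizing T with
  | nil => simp [lowerTrees] at h; subst h; exact .refl
  | node _ l r ihl ihr =>
    simp only [lowerTrees, List.mem_flatMap] at h
    obtain ⟨L, hL, S, hS, h⟩ := h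
    exact (tamariLE_of_mem_insertions h).trans (TamariLE.node (ihl hL) (ihr hS))

theorem self_mem_lowerTrees (T : BinaryTree Unit) : T ∈ lowerTrees T := by
  induction T with
  | nil => simp [lowerTrees]
  | node _ l r ihl ihr =>
    simp only [lowerTrees, List.mem_flatMap]
    exact ⟨l, ihl, r, ihr, head_mem_insertions l r⟩

theorem insertions_of_rightRotation_node {L S U : BinaryTree Unit}
    (hU : RightRotation U (.node () L S)) :
    ∃ L₁ S₁, (L₁ = L ∨ RightRotation L₁ L) ∧ (S₁ = S ∨ RightRotation S₁ S) ∧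
      U ∈ insertions L₁ S₁ := by
  cases hU with
  | root a b c =>
    exact ⟨_, _, Or.inl rfl, Or.inl rfl, map_mem_insertions c (head_mem_insertions _ _)⟩
  | left r h => exact ⟨_, _, Or.inr h, Or.inl rfl, head_mem_insertions _ _⟩
  | right l h => exact ⟨_, _, Or.inl rfl, Or.inr h, head_mem_insertions _ _⟩

/-- An inverse rotation of `T` takes place inside `L`, comes from an inverse rotation of `S`, or
moves `L` one step down the left spine of `S`. Hence the lists `lowerTrees` are closed under going
down. -/
theorem insertions_of_rightRotation {L S T U : BinaryTree Unit} (hT : T ∈ insertions L S)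
    (hU : RightRotation U T) :
    ∃ L₁ S₁, (L₁ = L ∨ RightRotation L₁ L) ∧ (S₁ = S ∨ RightRotation S₁ S) ∧
      U ∈ insertions L₁ S₁ := by
  induction S generalizing T U with
  | nil =>
    simp only [insertions, List.mem_singleton] at hT
    subst hT
    exact insertions_of_rightRotation_node hU
  | node _ s c ihs _ =>
    simp only [insertions, List.mem_cons, List.mem_map] at hT
    rcases hT with rfl | ⟨t, ht, rfl⟩
    · exact insertions_of_rightRotation_node hU
    · cases hU with
      | root a b c =>
        exact ⟨L, _, Or.inl rfl, Or.inr (.root s b c),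
          map_mem_insertions _ (map_mem_insertions b ht)⟩
      | left r h =>
        obtain ⟨L₁, S₁, hL, hS, hU⟩ := ihs ht h
        refine ⟨L₁, .node () S₁ c, hL, ?_, map_mem_insertions c hU⟩
        rcases hS with rfl | hS
        · exact Or.inl rfl
        · exact Or.inr (.left c hS)
      | right l h =>
        exact ⟨L, _, Or.inl rfl, Or.inr (.right s h), map_mem_insertions _ ht⟩

theorem mem_lowerTrees_of_rightRotation {T T' U : BinaryTree Unit} (hT : T ∈ lowerTrees T')
    (hU : RightRotation U T) : U ∈ lowerTrees T' := by
  induction T' generalizing T U with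
  | nil => simp [lowerTrees] at hT; subst hT; cases hU
  | node _ l r ihl ihr =>
    simp only [lowerTrees, List.mem_flatMap] at hT ⊢
    obtain ⟨L, hL, S, hS, hT⟩ := hT
    obtain ⟨L₁, S₁, hL₁, hS₁, h⟩ := insertions_of_rightRotation hT hU
    refine ⟨L₁, ?_, S₁, ?_, h⟩
    · rcases hL₁ with rfl | h
      exacts [hL, ihl hL h]
    · rcases hS₁ with rfl | h
      exacts [hS, ihr hS h]

theorem mem_lowerTrees {T T' : BinaryTree Unit} : T ∈ lowerTrees T' ↔ TamariLE T T' := by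
  refine ⟨tamariLE_of_mem_lowerTrees, fun h => ?_⟩
  induction h using Relation.ReflTransGen.head_induction_on with
  | refl => exact self_mem_lowerTrees T'
  | head h _ ih => exact mem_lowerTrees_of_rightRotation ih h

/-- Left subtrees shrink strictly along the left spine, so the size of `L` determines the node of
`T` at which `L` was inserted. -/
theorem insertions_inj {L₁ L₂ S₁ S₂ T : BinaryTree Unit} (hL : L₁.numNodes = L₂.numNodes)
    (h₁ : T ∈ insertions L₁ S₁) (h₂ : T ∈ insertions L₂ S₂) : L₁ = L₂ ∧ S₁ = S₂ := by
  have key : ∀ {L L' s t c S : BinaryTree Unit}, L.numNodes = L'.numNodes →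
      t ∈ insertions L s → BinaryTree.node () t c = .node () L' S → False := by
    intro L L' s t c S hL ht h
    have := numNodes_of_mem_insertions ht
    simp only [BinaryTree.node.injEq, true_and] at h
    rw [h.1] at this
    omega
  induction S₁ generalizing S₂ T with
  | nil =>
    simp only [insertions, List.mem_singleton] at h₁
    subst h₁
    cases S₂ with
    | nil => simpa [insertions] using h₂
    | node _ s c =>
      simp only [insertions, List.mem_cons, List.mem_map] at h₂
      rcases h₂ with h | ⟨t, ht, h⟩
      · simp at h
      · exact (key hL.symm ht h).elim
  | node _ s₁ c₁ ih _ =>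
    simp only [insertions, List.mem_cons, List.mem_map] at h₁
    rcases h₁ with rfl | ⟨t₁, ht₁, rfl⟩
    · cases S₂ with
      | nil => simp [insertions] at h₂
      | node _ s c =>
        simp only [insertions, List.mem_cons, List.mem_map] at h₂
        rcases h₂ with h | ⟨t, ht, h⟩
        · simpa using h
        · exact (key hL.symm ht h).elim
    · cases S₂ with
      | nil =>
        simp only [insertions, List.mem_singleton] at h₂
        exact (key hL ht₁ h₂).elim
      | node _ s c =>
        simp only [insertions, List.mem_cons, List.mem_map] at h₂
        rcases h₂ with h | ⟨t, ht, h⟩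
        · exact (key hL ht₁ h).elim
        · simp only [BinaryTree.node.injEq, true_and] at h
          obtain ⟨rfl, rfl⟩ := h
          obtain ⟨h, rfl⟩ := ih ht₁ ht
          exact ⟨h, rfl⟩

theorem nodup_insertions (L S : BinaryTree Unit) : (insertions L S).Nodup := by
  induction S with
  | nil => simp [insertions]
  | node _ s c ih _ =>
    simp only [insertions, List.nodup_cons, List.mem_map, not_exists, not_and]
    refine ⟨fun t ht h => ?_, ih.map fun a b h => by simpa using h⟩
    have := numNodes_of_mem_insertions ht
    simp only [BinaryTree.node.injEq, true_and] at h
    rw [h.1] at this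
    omega

theorem nodup_lowerTrees (T : BinaryTree Unit) : (lowerTrees T).Nodup := by
  induction T with
  | nil => simp [lowerTrees]
  | node _ l r ihl ihr =>
    rw [lowerTrees, List.nodup_flatMap]
    refine ⟨fun L hL => List.nodup_flatMap.2 ⟨fun S _ => nodup_insertions L S, ?_⟩, ?_⟩
    · refine ihr.imp fun {S₁ S₂} hne T h₁ h₂ => hne (insertions_inj rfl h₁ h₂).2
    · refine ihl.imp_of_mem fun {L₁ L₂} h₁ h₂ hne T hT₁ hT₂ => ?_
      simp only [List.mem_flatMap] at hT₁ hT₂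
      obtain ⟨S₁, -, hT₁⟩ := hT₁
      obtain ⟨S₂, -, hT₂⟩ := hT₂
      refine hne (insertions_inj ?_ hT₁ hT₂).1
      rw [numNodes_of_mem_lowerTrees h₁, numNodes_of_mem_lowerTrees h₂]

/-! ### Canopy and left spine of an insertion -/

/-- The types of the leaves of a tree from left to right, without the first leaf. -/
def innerTypes (T : BinaryTree Unit) : List Bool := (leafTypes true T).tail

/-- Whether a tree has at least one node. -/
def hasNode : BinaryTree Unit → Bool
  | .nil => false
  | .node _ _ _ => true

theorem leafTypes_true (T : BinaryTree Unit) : leafTypes true T = true :: innerTypes T := by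
  induction T with
  | nil => rfl
  | node _ l r ihl _ => rw [innerTypes, leafTypes, ihl]; rfl

theorem leafTypes_false (T : BinaryTree Unit) :
    leafTypes false T = hasNode T :: innerTypes T := by
  cases T with
  | nil => rfl
  | node _ l r => exact leafTypes_true (.node () l r)

theorem canopy_eq {T : BinaryTree Unit} (h : 0 < T.numNodes) : canopy T = true :: innerTypes T := by
  cases T with
  | nil => simp [BinaryTree.numNodes] at h
  | node _ l r => exact leafTypes_true (.node () l r)

theorem innerTypes_node (l r : BinaryTree Unit) :
    innerTypes (.node () l r) = innerTypes l ++ hasNode r :: innerTypes r := by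
  rw [innerTypes, leafTypes, leafTypes_true, leafTypes_false]; rfl

theorem length_innerTypes (T : BinaryTree Unit) : (innerTypes T).length = T.numNodes := by
  induction T with
  | nil => rfl
  | node _ l r ihl ihr =>
    rw [innerTypes_node, List.length_append, List.length_cons, ihl, ihr, BinaryTree.numNodes]; omega

/-- Here `k` is the number of spine nodes of `S` above the insertion place. They remain on the left
spine, followed by the new node and the spine of `L`. The first leaf of `S` becomes the first leaf
of the new right subtree, which is a single leaf only for `k = spine S`; this decides its type. -/
theorem map_insertions (L S : BinaryTree Unit) :
    (insertions L S).map (fun T => (innerTypes T, spine T)) =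
      (List.range (spine S + 1)).map fun k =>
        (innerTypes L ++ decide (k < spine S) :: innerTypes S, k + 1 + spine L) := by
  induction S with
  | nil => simp [insertions, spine, innerTypes_node, hasNode, add_comm]
  | node _ s c ih _ =>
    have ih' := congrArg (List.map fun p : List Bool × ℕ =>
      (p.1 ++ hasNode c :: innerTypes c, p.2 + 1)) ih
    simp only [List.map_map] at ih'
    rw [spine, List.range_succ_eq_map, insertions]
    simp only [List.map_cons, List.map_map, List.cons.injEq]
    refine ⟨?_, ?_⟩
    · rw [innerTypes_node]
      simp [spine, hasNode, add_comm]
    · refine Eq.trans (List.map_congr_left fun T _ => ?_)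
        (ih'.trans (List.map_congr_left fun k _ => ?_))
      · simp [innerTypes_node, spine]
      · have h : innerTypes (.node _ s c) = _ := innerTypes_node s c
        simp only [Function.comp_apply, Prod.mk.injEq, h, Nat.succ_eq_add_one,
          add_lt_add_iff_right, List.append_assoc, List.cons_append, true_and]
        omega

/-! ### Order filtration and canopy weights -/

/-- The series of order at least `N` for the total degree. -/
def orderIdeal (N : ℕ) : Ideal Series where
  carrier := {f | ∀ d : Fin 3 →₀ ℕ, d.degree < N → MvPowerSeries.coeff d f = 0}
  add_mem' {f g} hf hg d hd := by rw [map_add, hf d hd, hg d hd, add_zero]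
  zero_mem' d _ := by simp
  smul_mem' c f hf d hd := by
    rw [smul_eq_mul, MvPowerSeries.coeff_mul]
    refine Finset.sum_eq_zero fun p hp => ?_
    rw [Finset.HasAntidiagonal.mem_antidiagonal] at hp
    rw [hf p.2 (lt_of_le_of_lt (by rw [← hp, map_add]; omega) hd), mul_zero]

theorem orderIdeal_zero : orderIdeal 0 = ⊤ :=
  (Ideal.eq_top_iff_one _).2 fun _ h => (Nat.not_lt_zero _ h).elim

theorem orderIdeal_anti {M N : ℕ} (h : M ≤ N) : orderIdeal N ≤ orderIdeal M :=
  fun _ hf d hd => hf d (hd.trans_le h)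

theorem mul_mem_orderIdeal {M N : ℕ} {f g : Series} (hf : f ∈ orderIdeal M)
    (hg : g ∈ orderIdeal N) : f * g ∈ orderIdeal (M + N) := by
  intro d hd
  rw [MvPowerSeries.coeff_mul]
  refine Finset.sum_eq_zero fun p hp => ?_
  rw [Finset.HasAntidiagonal.mem_antidiagonal] at hp
  have : p.1.degree + p.2.degree = d.degree := by rw [← hp, map_add]
  by_cases h : p.1.degree < M
  · rw [hf _ h, zero_mul]
  · rw [hg p.2 (by omega), mul_zero]

theorem X_mem_orderIdeal (i : Fin 3) : (MvPowerSeries.X i : Series) ∈ orderIdeal 1 := by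
  intro d hd
  have : d = 0 := by rw [← Finsupp.degree_eq_zero_iff]; omega
  subst this
  simp

theorem x_mem_orderIdeal : x ∈ orderIdeal 1 := X_mem_orderIdeal 0
theorem y_mem_orderIdeal : y ∈ orderIdeal 1 := X_mem_orderIdeal 1
theorem z_mem_orderIdeal : z ∈ orderIdeal 1 := X_mem_orderIdeal 2

/-- The weight of a canopy-entry with upper entry `p` and lower entry `q`. -/
noncomputable def entryWeight : Bool → Bool → Series
  | true, true => x
  | false, false => y
  | true, false => z
  | false, true => 0

theorem entryWeight_mem (p q : Bool) : entryWeight p q ∈ orderIdeal 1 := by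
  cases p <;> cases q
  exacts [y_mem_orderIdeal, Ideal.zero_mem _, z_mem_orderIdeal, x_mem_orderIdeal]

/-- The product of the weights of the pairs of entries of two words. -/
noncomputable def wordWeight : List Bool → List Bool → Series
  | p :: v, q :: w => entryWeight p q * wordWeight v w
  | _, _ => 1

theorem wordWeight_append {v w : List Bool} (h : v.length = w.length) (v' w' : List Bool) :
    wordWeight (v ++ v') (w ++ w') = wordWeight v w * wordWeight v' w' := by
  induction v generalizing w with
  | nil => cases w <;> simp_all [wordWeight]
  | cons p v ih =>
    cases w with
    | nil => simp at h
    | cons q w =>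
      simp only [List.length_cons, add_left_inj] at h
      simp only [List.cons_append, wordWeight, ih h, mul_assoc]

theorem wordWeight_mem {v w : List Bool} (h : v.length = w.length) :
    wordWeight v w ∈ orderIdeal v.length := by
  induction v generalizing w with
  | nil => simp [orderIdeal_zero]
  | cons p v ih =>
    cases w with
    | nil => simp at h
    | cons q w =>
      simp only [List.length_cons, add_left_inj] at h
      rw [List.length_cons, add_comm]
      exact mul_mem_orderIdeal (entryWeight_mem p q) (ih h)

/-- The weight of a pair of trees, the first canopy-entry being disregarded. -/
noncomputable def innerWeight (T' T : BinaryTree Unit) : Series :=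
  wordWeight (innerTypes T') (innerTypes T)

theorem innerWeight_mem {T T' : BinaryTree Unit} (h : T ∈ lowerTrees T') :
    innerWeight T' T ∈ orderIdeal T'.numNodes := by
  rw [← length_innerTypes]
  apply wordWeight_mem
  rw [length_innerTypes, length_innerTypes, numNodes_of_mem_lowerTrees h]

/-! ### Generating polynomials with the spine as catalytic parameter -/

/-- The polynomial that counts the trees below `T'` by weight and length of the left spine. -/
noncomputable def lowerPoly (T' : BinaryTree Unit) : Series[X] :=
  ((lowerTrees T').map fun T => C (innerWeight T' T) * X ^ spine T).sum

/-- The contribution to `lowerPoly` of an upper tree as right subtree of the root. -/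
noncomputable def rightPoly (R' : BinaryTree Unit) : Series[X] :=
  ((lowerTrees R').map fun S => C (innerWeight R' S) *
    ((List.range (spine S + 1)).map fun k =>
      C (entryWeight (hasNode R') (decide (k < spine S))) * X ^ k).sum).sum

theorem sum_map_flatMap {α β M : Type*} [AddCommMonoid M] (l : List α) (f : α → List β)
    (g : β → M) : ((l.flatMap f).map g).sum = (l.map fun a => ((f a).map g).sum).sum := by
  induction l with
  | nil => simp
  | cons a l ih => simp [ih]

/-- By `map_insertions` weight and spine split into a part from `L` and a part from `S` and `k`; the
factor `X` stands for the new node on the spine. -/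
theorem lowerPoly_node (L' R' : BinaryTree Unit) :
    lowerPoly (.node () L' R') = X * lowerPoly L' * rightPoly R' := by
  rw [lowerPoly, lowerTrees, sum_map_flatMap, lowerPoly, rightPoly, mul_assoc,
    ← List.sum_map_mul_right, ← List.sum_map_mul_left]
  congr 1
  refine List.map_congr_left fun L hL => ?_
  rw [sum_map_flatMap, ← List.sum_map_mul_left, ← List.sum_map_mul_left]
  congr 1
  refine List.map_congr_left fun S hS => ?_
  have h := congrArg (List.map fun p : List Bool × ℕ =>
    C (wordWeight (innerTypes (.node () L' R')) p.1) * X ^ p.2) (map_insertions L S)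
  rw [List.map_map, List.map_map] at h
  refine (congrArg List.sum h).trans ?_
  rw [← List.sum_map_mul_left, ← List.sum_map_mul_left, ← List.sum_map_mul_left]
  congr 1
  refine List.map_congr_left fun k _ => ?_
  have hlen : (innerTypes L').length = (innerTypes L).length := by
    rw [length_innerTypes, length_innerTypes, numNodes_of_mem_lowerTrees hL]
  simp only [Function.comp_apply, innerTypes_node, wordWeight_append hlen, wordWeight,
    innerWeight, map_mul]
  ring

theorem lowerPoly_nil : lowerPoly .nil = 1 := by
  simp [lowerPoly, lowerTrees, innerWeight, innerTypes, leafTypes, wordWeight, spine]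

theorem rightPoly_nil : rightPoly .nil = C y := by
  simp [rightPoly, lowerTrees, innerWeight, innerTypes, leafTypes, wordWeight, spine, hasNode,
    entryWeight]

/-- A geometric sum: the places `k < s` have weight `x`, the last place, at the leaf, has weight
`z`. -/
theorem sum_range_entryWeight (s : ℕ) :
    (X - 1) * ((List.range (s + 1)).map fun k =>
      C (entryWeight true (decide (k < s))) * X ^ k).sum =
    C x * (X ^ s - 1) + (X - 1) * C z * X ^ s := by
  have h : ((List.range s).map fun k => C (entryWeight true (decide (k < s))) * X ^ k) =
      (List.range s).map fun k => C x * X ^ k :=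
    List.map_congr_left fun k hk => by simp [List.mem_range.1 hk, entryWeight]
  have hg : ((List.range s).map fun k => (X : Series[X]) ^ k).sum = ∑ k ∈ Finset.range s, X ^ k := by
    rfl
  rw [List.range_succ, List.map_append, List.sum_append, h, List.sum_map_mul_left, hg, mul_add,
    mul_left_comm, mul_comm (X - 1) (Finset.sum _ _), geom_sum_mul]
  simp [entryWeight, mul_assoc]

theorem rightPoly_node (l r : BinaryTree Unit) :
    (X - 1) * rightPoly (.node () l r) =
      C x * (lowerPoly (.node () l r) - C ((lowerPoly (.node () l r)).eval 1)) +
        (X - 1) * C z * lowerPoly (.node () l r) := by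
  have : ∀ w : List (BinaryTree Unit), ∀ c : BinaryTree Unit → Series,
      (X - 1) * (w.map fun S => C (c S) * ((List.range (spine S + 1)).map fun k =>
        C (entryWeight true (decide (k < spine S))) * X ^ k).sum).sum =
      C x * ((w.map fun S => C (c S) * X ^ spine S).sum -
        C ((w.map fun S => C (c S) * X ^ spine S).sum.eval 1)) +
        (X - 1) * C z * (w.map fun S => C (c S) * X ^ spine S).sum := by
    intro w c
    induction w with
    | nil => simp
    | cons S w ih =>
      simp only [List.map_cons, List.sum_cons, mul_add, ih, eval_add, eval_mul, eval_C, eval_pow,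
        eval_X, one_pow, mul_one, map_add]
      linear_combination C (c S) * sum_range_entryWeight (spine S)
  exact this _ _

theorem mul_mem_map_C {M N : ℕ} {f g : Series[X]} (hf : f ∈ (orderIdeal M).map C)
    (hg : g ∈ (orderIdeal N).map C) : f * g ∈ (orderIdeal (M + N)).map C := by
  rw [Ideal.mem_map_C_iff] at *
  intro n
  rw [coeff_mul]
  exact Ideal.sum_mem _ fun p _ => mul_mem_orderIdeal (hf _) (hg _)

theorem list_sum_mem {R : Type*} [CommRing R] (I : Ideal R) {l : List R} (h : ∀ a ∈ l, a ∈ I) :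
    l.sum ∈ I := by
  induction l with
  | nil => simp
  | cons a l ih =>
    rw [List.sum_cons]
    exact I.add_mem (h a (by simp)) (ih fun b hb => h b (by simp [hb]))

theorem lowerPoly_mem (T : BinaryTree Unit) : lowerPoly T ∈ (orderIdeal T.numNodes).map C := by
  refine list_sum_mem _ fun f hf => ?_
  obtain ⟨S, hS, rfl⟩ := List.mem_map.1 hf
  exact Ideal.mul_mem_right _ _ (Ideal.mem_map_of_mem _ (innerWeight_mem hS))

theorem rightPoly_mem (T : BinaryTree Unit) :
    rightPoly T ∈ (orderIdeal (T.numNodes + 1)).map C := by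
  refine list_sum_mem _ fun f hf => ?_
  obtain ⟨S, hS, rfl⟩ := List.mem_map.1 hf
  refine mul_mem_map_C (Ideal.mem_map_of_mem _ (innerWeight_mem hS))
    (list_sum_mem _ fun f hf => ?_)
  obtain ⟨k, -, rfl⟩ := List.mem_map.1 hf
  exact Ideal.mul_mem_right _ _ (Ideal.mem_map_of_mem _ (entryWeight_mem _ _))

/-! ### Summation over upper trees and the functional equation -/

/-- The polynomial that counts the intervals of size `n`. -/
noncomputable def sizePoly (n : ℕ) : Series[X] :=
  ∑ T ∈ BinaryTree.treesOfNumNodesEq n, lowerPoly T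

/-- The sum of `rightPoly` over the trees of size `n`. -/
noncomputable def sizeRightPoly (n : ℕ) : Series[X] :=
  ∑ T ∈ BinaryTree.treesOfNumNodesEq n, rightPoly T

theorem sizePoly_mem (n : ℕ) : sizePoly n ∈ (orderIdeal n).map C :=
  Ideal.sum_mem _ fun T hT => by
    rw [← BinaryTree.mem_treesOfNumNodesEq.1 hT]; exact lowerPoly_mem T

theorem sizeRightPoly_mem (n : ℕ) : sizeRightPoly n ∈ (orderIdeal (n + 1)).map C :=
  Ideal.sum_mem _ fun T hT => by
    rw [← BinaryTree.mem_treesOfNumNodesEq.1 hT]; exact rightPoly_mem T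

theorem sizePoly_zero : sizePoly 0 = 1 := by
  simp [sizePoly, BinaryTree.treesOfNumNodesEq_zero, lowerPoly_nil]

theorem sizeRightPoly_zero : sizeRightPoly 0 = C y := by
  simp [sizeRightPoly, BinaryTree.treesOfNumNodesEq_zero, rightPoly_nil]

theorem sizePoly_succ (n : ℕ) :
    sizePoly (n + 1) = X * ∑ p ∈ Finset.HasAntidiagonal.antidiagonal n, sizePoly p.1 * sizeRightPoly p.2 := by
  rw [sizePoly, BinaryTree.treesOfNumNodesEq_succ, Finset.sum_biUnion, Finset.mul_sum]
  · refine Finset.sum_congr rfl fun p _ => ?_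
    rw [BinaryTree.pairwiseNode, Finset.sum_map, Finset.sum_product, sizePoly, sizeRightPoly,
      Finset.sum_mul_sum, Finset.mul_sum]
    refine Finset.sum_congr rfl fun L _ => ?_
    rw [Finset.mul_sum]
    refine Finset.sum_congr rfl fun R _ => ?_
    exact (lowerPoly_node L R).trans (mul_assoc _ _ _)
  · rintro p - q - hpq
    refine Finset.disjoint_left.2 fun T hp hq => hpq ?_
    simp only [BinaryTree.pairwiseNode, Finset.mem_map, Finset.mem_product,
      BinaryTree.mem_treesOfNumNodesEq, Prod.exists] at hp hq
    obtain ⟨a, b, ⟨h1, h2⟩, rfl⟩ := hp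
    obtain ⟨c, d, ⟨h3, h4⟩, h⟩ := hq
    injection h with _ hl hr
    subst hl hr
    exact Prod.ext (h1.symm.trans h3) (h2.symm.trans h4)

theorem sizeRightPoly_succ (n : ℕ) :
    (X - 1) * sizeRightPoly (n + 1) = C x * (sizePoly (n + 1) - C ((sizePoly (n + 1)).eval 1)) +
      (X - 1) * C z * sizePoly (n + 1) := by
  simp only [sizeRightPoly, sizePoly, eval_finsetSum, map_sum, ← Finset.sum_sub_distrib,
    Finset.mul_sum, ← Finset.sum_add_distrib]
  refine Finset.sum_congr rfl fun T hT => ?_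
  cases T with
  | nil => simp [BinaryTree.numNodes] at hT
  | node _ l r => exact rightPoly_node l r

/-- The polynomial that counts the intervals of size at most `N`. -/
noncomputable def truncPoly (N : ℕ) : Series[X] := ∑ n ∈ Finset.range (N + 1), sizePoly n

/-- The correction `y - z` comes from size `0`: the recursion for positive sizes would give `z`
there, while a leaf as upper right subtree contributes `y`. -/
theorem truncRightPoly_eq (N : ℕ) :
    (X - 1) * ∑ n ∈ Finset.range (N + 1), sizeRightPoly n =
      (X - 1) * C (y - z) + C x * (truncPoly N - C ((truncPoly N).eval 1)) +
        (X - 1) * C z * truncPoly N := by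
  rw [truncPoly]
  induction N with
  | zero => simp [sizePoly_zero, sizeRightPoly_zero]; ring
  | succ N ih =>
    rw [Finset.sum_range_succ, mul_add, ih, sizeRightPoly_succ,
      Finset.sum_range_succ sizePoly (N + 1), eval_add, C_add]
    ring

theorem sum_range_mul_sum_range_sub_mem (I : Ideal Series[X]) (a b : ℕ → Series[X]) (N : ℕ)
    (h : ∀ i j, N ≤ i + j → a i * b j ∈ I) :
    (∑ i ∈ Finset.range (N + 1), a i) * (∑ j ∈ Finset.range (N + 1), b j) -
      ∑ n ∈ Finset.range N, ∑ p ∈ Finset.HasAntidiagonal.antidiagonal n, a p.1 * b p.2 ∈ I := by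
  have h1 : ∑ n ∈ Finset.range N, ∑ p ∈ Finset.HasAntidiagonal.antidiagonal n, a p.1 * b p.2 =
      ∑ p ∈ (Finset.range (N + 1) ×ˢ Finset.range (N + 1)) with p.1 + p.2 < N,
        a p.1 * b p.2 := by
    rw [← Finset.sum_biUnion]
    · refine Finset.sum_congr ?_ fun _ _ => rfl
      ext p
      simp only [Finset.mem_biUnion, Finset.mem_range, Finset.HasAntidiagonal.mem_antidiagonal, Finset.mem_filter,
        Finset.mem_product]
      constructor
      · rintro ⟨n, hn, rfl⟩; omega
      · rintro ⟨-, h⟩; exact ⟨_, h, rfl⟩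
    · intro m _ n _ hmn
      refine Finset.disjoint_left.2 fun p hp hq => hmn ?_
      rw [Finset.HasAntidiagonal.mem_antidiagonal] at hp hq
      exact hp.symm.trans hq
  rw [Finset.sum_mul_sum, ← Finset.sum_product', h1,
    ← Finset.sum_filter_add_sum_filter_not _ fun p : ℕ × ℕ => p.1 + p.2 < N, add_sub_cancel_left]
  refine Ideal.sum_mem _ fun p hp => h _ _ ?_
  have := (Finset.mem_filter.1 hp).2
  omega

/-- The functional equation with catalytic variable `X`, up to terms of order above `N`. -/
theorem truncPoly_functional (N : ℕ) :
    X * truncPoly N * ((X - 1) * C (y - z) + C x * (truncPoly N - C ((truncPoly N).eval 1)) +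
        (X - 1) * C z * truncPoly N) - (X - 1) * (truncPoly N - 1) ∈
      (orderIdeal (N + 1)).map C := by
  -- The products of sizes `i + j ≥ N` that are left over have order at least `i + (j + 1)`, because
  -- `sizeRightPoly j` carries one more entry.
  have h := sum_range_mul_sum_range_sub_mem ((orderIdeal (N + 1)).map C) sizePoly sizeRightPoly N
    fun i j hij => Ideal.map_mono (orderIdeal_anti (by omega : N + 1 ≤ i + (j + 1)))
      (mul_mem_map_C (sizePoly_mem i) (sizeRightPoly_mem j))
  have h2 : truncPoly N - 1 = X * ∑ n ∈ Finset.range N,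
      ∑ p ∈ Finset.HasAntidiagonal.antidiagonal n, sizePoly p.1 * sizeRightPoly p.2 := by
    rw [truncPoly, Finset.sum_range_succ', sizePoly_zero, Finset.mul_sum, add_sub_cancel_right]
    exact Finset.sum_congr rfl fun n _ => sizePoly_succ n
  rw [← truncRightPoly_eq, h2]
  convert Ideal.mul_mem_left _ (X * (X - 1)) h using 1
  rw [truncPoly]
  ring

/-! ### From weights to the numbers of intervals -/

theorem wordWeight_eq {v w : List Bool} (h : v.length = w.length) :
    wordWeight v w = x ^ (v.zip w).count (true, true) * y ^ (v.zip w).count (false, false) *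
      z ^ (v.zip w).count (true, false) * 0 ^ (v.zip w).count (false, true) := by
  induction v generalizing w with
  | nil => simp [wordWeight]
  | cons p v ih =>
    cases w with
    | nil => simp at h
    | cons q w =>
      simp only [List.length_cons, add_left_inj] at h
      rw [wordWeight, ih h]
      cases p <;> cases q <;>
        simp only [entryWeight, List.zip_cons_cons, List.count_cons, beq_self_eq_true, if_true,
          Prod.mk.injEq, beq_iff_eq, Bool.true_eq_false, Bool.false_eq_true, and_true, and_false,
          and_self, if_false, add_zero, pow_succ] <;> ring

theorem sum_count_zip {v w : List Bool} (h : v.length = w.length) :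
    (v.zip w).count (true, true) + (v.zip w).count (false, false) +
      (v.zip w).count (true, false) + (v.zip w).count (false, true) = v.length := by
  induction v generalizing w with
  | nil => simp
  | cons p v ih =>
    cases w with
    | nil => simp at h
    | cons q w =>
      simp only [List.length_cons, add_left_inj] at h
      rw [List.length_cons, ← ih h]
      cases p <;> cases q <;>
        simp only [List.zip_cons_cons, List.count_cons, beq_self_eq_true, if_true,
          Prod.mk.injEq, beq_iff_eq, Bool.true_eq_false, Bool.false_eq_true, and_true, and_false,
          and_self, if_false, add_zero] <;> omega

theorem coeff_xyz (a b c : ℕ) (d : Fin 3 →₀ ℕ) :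
    MvPowerSeries.coeff d (x ^ a * y ^ b * z ^ c) =
      if a = d 0 ∧ b = d 1 ∧ c = d 2 then 1 else 0 := by
  rw [x, y, z, MvPowerSeries.X_pow_eq, MvPowerSeries.X_pow_eq, MvPowerSeries.X_pow_eq,
    MvPowerSeries.monomial_mul_monomial, MvPowerSeries.monomial_mul_monomial,
    MvPowerSeries.coeff_monomial]
  simp only [mul_one]
  congr 1
  rw [eq_iff_iff, Finsupp.ext_iff, Fin.forall_fin_succ, Fin.forall_fin_succ, Fin.forall_fin_succ]
  simp [Finsupp.single_apply, eq_comm]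

theorem degree_eq (d : Fin 3 →₀ ℕ) : d.degree = d 0 + d 1 + d 2 := by
  rw [Finsupp.degree_eq_sum, Fin.sum_univ_three]

/-- The factor `x` restores the first canopy-entry, which is `1` in both trees. Entries `[0; 1]`
need not be excluded beforehand: they give weight `0`, and with one present the other three counts
cannot add up to `n + 1`. -/
theorem coeff_weight {T T' : BinaryTree Unit} {n : ℕ} (hn : 1 ≤ n) (hT : T.numNodes = n)
    (hT' : T'.numNodes = n) (d : Fin 3 →₀ ℕ) :
    MvPowerSeries.coeff d (x * innerWeight T' T) =
      if n + 1 = d 0 + d 1 + d 2 ∧ canopyCount true true (T, T') = d 0 ∧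
        canopyCount false false (T, T') = d 1 ∧ canopyCount true false (T, T') = d 2
      then 1 else 0 := by
  have hc : x * innerWeight T' T = wordWeight (canopy T') (canopy T) := by
    rw [canopy_eq (by omega), canopy_eq (by omega)]; rfl
  have hl' : (canopy T').length = n + 1 := by
    rw [canopy_eq (by omega), List.length_cons, length_innerTypes, hT']
  have hl : (canopy T').length = (canopy T).length := by
    rw [hl', canopy_eq (by omega), List.length_cons, length_innerTypes, hT]
  have hs : canopyCount true true (T, T') + canopyCount false false (T, T') +
      canopyCount true false (T, T') + canopyCount false true (T, T') = n + 1 :=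
    (sum_count_zip hl).trans hl'
  have hw : wordWeight (canopy T') (canopy T) = x ^ canopyCount true true (T, T') *
      y ^ canopyCount false false (T, T') * z ^ canopyCount true false (T, T') *
      0 ^ canopyCount false true (T, T') := wordWeight_eq hl
  rw [hc, hw]
  by_cases h0 : canopyCount false true (T, T') = 0
  · rw [h0, pow_zero, mul_one, coeff_xyz]
    congr 1
    rw [eq_iff_iff]
    omega
  · rw [zero_pow h0, mul_zero, map_zero, if_neg]
    omega

theorem coeff_sizePoly {n : ℕ} (hn : 1 ≤ n) (d : Fin 3 →₀ ℕ) :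
    MvPowerSeries.coeff d (x * (sizePoly n).eval 1) =
      if n + 1 = d.degree then (numIntervals (d 0) (d 1) (d 2) : ℚ) else 0 := by
  classical
  have key : MvPowerSeries.coeff d (x * (sizePoly n).eval 1) =
      (((BinaryTree.treesOfNumNodesEq n ×ˢ BinaryTree.treesOfNumNodesEq n).filter fun I =>
        TamariLE I.2 I.1 ∧ n + 1 = d 0 + d 1 + d 2 ∧ canopyCount true true I.swap = d 0 ∧
        canopyCount false false I.swap = d 1 ∧ canopyCount true false I.swap = d 2).card : ℚ) := by
    rw [Finset.card_filter, Finset.sum_product, sizePoly, eval_finsetSum, Finset.mul_sum, map_sum,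
      Nat.cast_sum]
    refine Finset.sum_congr rfl fun T' hT' => ?_
    rw [BinaryTree.mem_treesOfNumNodesEq] at hT'
    have h1 : (lowerPoly T').eval 1 = ∑ T ∈ (lowerTrees T').toFinset, innerWeight T' T := by
      rw [List.sum_toFinset _ (nodup_lowerTrees T'), lowerPoly, ← coe_evalRingHom, map_list_sum,
        List.map_map]
      congr 1
      exact List.map_congr_left fun T _ => by simp
    have h2 : (lowerTrees T').toFinset =
        (BinaryTree.treesOfNumNodesEq n).filter fun T => TamariLE T T' := by
      ext T
      rw [List.mem_toFinset, Finset.mem_filter, BinaryTree.mem_treesOfNumNodesEq,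
        ← mem_lowerTrees]
      exact ⟨fun h => ⟨(numNodes_of_mem_lowerTrees h).trans hT', h⟩, fun h => h.2⟩
    rw [h1, h2, Finset.sum_filter, Finset.mul_sum, map_sum, Nat.cast_sum]
    refine Finset.sum_congr rfl fun T hT => ?_
    rw [BinaryTree.mem_treesOfNumNodesEq] at hT
    by_cases h : TamariLE T T'
    · rw [if_pos h, coeff_weight hn hT hT']
      simp [h]
    · simp [h]
  rw [key]
  split_ifs with h
  · rw [numIntervals, ← Set.ncard_coe_finset, ← Set.ncard_image_of_injective _ Prod.swap_injective]
    congr 2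
    ext ⟨T, T'⟩
    rw [degree_eq] at h
    simp only [Set.image_swap_eq_preimage_swap, Set.mem_preimage, Finset.mem_coe,
      Finset.mem_filter, Finset.mem_product, BinaryTree.mem_treesOfNumNodesEq, Prod.swap_prod_mk,
      intervalsByCanopy, tamariIntervals, Set.mem_ofPred_eq]
    constructor
    · rintro ⟨⟨h1, h2⟩, h3, h4, h5⟩
      exact ⟨n, hn, h, ⟨h2, h1, h3⟩, h5⟩
    · rintro ⟨m, -, hm, ⟨h2, h1, h3⟩, h5⟩
      obtain rfl : m = n := by omega
      exact ⟨⟨h1, h2⟩, h3, h, h5⟩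
  · rw [degree_eq] at h
    simp [h]

theorem numIntervals_eq_zero {i j m : ℕ} (h : i + j + m ≤ 1) : numIntervals i j m = 0 := by
  rw [numIntervals, Set.ncard_eq_zero (intervalsByCanopy_finite i j m),
    Set.eq_empty_iff_forall_notMem]
  rintro I ⟨n, hn, hn', -⟩
  omega

theorem intervalSeries_sub_mem (N : ℕ) :
    intervalSeries - x * ((truncPoly N).eval 1 - 1) ∈ orderIdeal (N + 1) := by
  intro d hd
  have h : truncPoly N = ∑ n ∈ Finset.range N, sizePoly (n + 1) + 1 := by
    rw [truncPoly, Finset.sum_range_succ', sizePoly_zero]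
  rw [h, eval_add, eval_one, add_sub_cancel_right, eval_finsetSum, Finset.mul_sum, map_sub,
    map_sum, coeff_intervalSeries, Finset.sum_congr rfl fun n _ => coeff_sizePoly (Nat.succ_pos n) d]
  rcases Nat.lt_or_ge 1 d.degree with h1 | h1
  -- Degree `d` means size `d - 1`, and the index is shifted by one as size `0` was split off.
  · rw [Finset.sum_eq_single (d.degree - 2), if_pos (by omega), sub_self]
    · intro n _ hn
      rw [if_neg (by omega)]
    · intro hn
      rw [Finset.mem_range] at hn
      omega
  · rw [numIntervals_eq_zero (by rw [← degree_eq]; exact h1), Finset.sum_eq_zero]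
    · simp
    · intro n _
      rw [if_neg (by omega)]

/-! ### Contractions on pairs of series -/

/-- Congruence of pairs of series up to terms of order at least `N`. -/
def CongMod (N : ℕ) (p q : Series × Series) : Prop :=
  p.1 - q.1 ∈ orderIdeal N ∧ p.2 - q.2 ∈ orderIdeal N

theorem CongMod.refl (N : ℕ) (p : Series × Series) : CongMod N p p := by
  simp [CongMod]

theorem CongMod.symm {N : ℕ} {p q : Series × Series} (h : CongMod N p q) : CongMod N q p := by
  constructor
  · rw [← neg_sub]; exact neg_mem h.1
  · rw [← neg_sub]; exact neg_mem h.2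

theorem CongMod.trans {N : ℕ} {p q r : Series × Series} (h : CongMod N p q)
    (h' : CongMod N q r) : CongMod N p r := by
  constructor
  · rw [← sub_add_sub_cancel _ q.1]; exact add_mem h.1 h'.1
  · rw [← sub_add_sub_cancel _ q.2]; exact add_mem h.2 h'.2

theorem CongMod.mono {M N : ℕ} (hMN : M ≤ N) {p q : Series × Series} (h : CongMod N p q) :
    CongMod M p q :=
  ⟨orderIdeal_anti hMN h.1, orderIdeal_anti hMN h.2⟩

theorem congMod_zero (p q : Series × Series) : CongMod 0 p q := by
  simp [CongMod, orderIdeal_zero]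

theorem eq_of_sub_mem {f g : Series} (h : ∀ N, f - g ∈ orderIdeal N) : f = g := by
  ext d
  have := h (d.degree + 1) d (Nat.lt_succ_self _)
  rwa [map_sub, sub_eq_zero] at this

/-- A map on pairs of series that increases the order of congruences. -/
def IsContraction (Φ : Series × Series → Series × Series) : Prop :=
  ∀ N p q, CongMod N p q → CongMod (N + 1) (Φ p) (Φ q)

/-- Agreement to order `k` passes through `Φ` to order `k + 1`, and fixedness up to order `N`
removes `Φ` again as long as `k + 1 ≤ N`. This serves both for uniqueness and for comparing
approximate with exact solutions. -/
theorem IsContraction.congMod {Φ : Series × Series → Series × Series} (hΦ : IsContraction Φ)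
    {N : ℕ} {p q : Series × Series} (hp : CongMod N (Φ p) p) (hq : CongMod N (Φ q) q) :
    CongMod N p q := by
  have : ∀ k ≤ N, CongMod k p q := by
    intro k
    induction k with
    | zero => exact fun _ => congMod_zero p q
    | succ k ih =>
      exact fun hk => ((hp.mono hk).symm.trans (hΦ k p q (ih (by omega)))).trans (hq.mono hk)
  exact this N le_rfl

/-- The coefficientwise limit of a sequence of series. -/
noncomputable def seqLimit (f : ℕ → Series) : Series := fun d => MvPowerSeries.coeff d (f (d.degree + 1))

theorem seqLimit_sub_mem {f : ℕ → Series} (h : ∀ k m, k ≤ m → f m - f k ∈ orderIdeal k) (k : ℕ) :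
    seqLimit f - f k ∈ orderIdeal k := by
  intro d hd
  have := h (d.degree + 1) k hd d (Nat.lt_succ_self _)
  rw [map_sub, sub_eq_zero] at this ⊢
  exact this.symm

theorem IsContraction.exists_fixed {Φ : Series × Series → Series × Series}
    (hΦ : IsContraction Φ) : ∃ p, Φ p = p := by
  have h1 : ∀ k, CongMod k (Φ^[k + 1] 0) (Φ^[k] 0) := by
    intro k
    induction k with
    | zero => exact congMod_zero _ _
    | succ k ih =>
      rw [Function.iterate_succ_apply', Function.iterate_succ_apply']
      rw [Function.iterate_succ_apply'] at ih
      exact hΦ _ _ _ ih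
  have h2 : ∀ k m, k ≤ m → CongMod k (Φ^[m] 0) (Φ^[k] 0) := by
    intro k m hkm
    induction m, hkm using Nat.le_induction with
    | base => exact CongMod.refl _ _
    | succ m hm ih => exact ((h1 m).mono hm).trans ih
  let p : Series × Series := (seqLimit fun k => (Φ^[k] 0).1, seqLimit fun k => (Φ^[k] 0).2)
  have h3 : ∀ k, CongMod k p (Φ^[k] 0) := fun k =>
    ⟨seqLimit_sub_mem (fun k m h => (h2 k m h).1) k, seqLimit_sub_mem (fun k m h => (h2 k m h).2) k⟩
  have h4 : ∀ k, CongMod k (Φ p) p := by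
    intro k
    have h := hΦ k _ _ (h3 k)
    rw [← Function.iterate_succ_apply' Φ k 0] at h
    exact (h.trans (h3 (k + 1)).symm).mono (Nat.le_succ k)
  exact ⟨p, Prod.ext (eq_of_sub_mem fun N => (h4 N).1) (eq_of_sub_mem fun N => (h4 N).2)⟩

/-! ### The system for `A` and `B` -/

theorem constantCoeff_eq_zero_of_mem {f : Series} {N : ℕ} (hN : 0 < N) (h : f ∈ orderIdeal N) :
    MvPowerSeries.constantCoeff f = 0 :=
  h 0 (by simpa using hN)

theorem constantCoeff_ne_zero {f : Series} (h : f - 1 ∈ orderIdeal 1) :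
    MvPowerSeries.constantCoeff f ≠ 0 := by
  have := constantCoeff_eq_zero_of_mem one_pos h
  rw [map_sub, map_one, sub_eq_zero] at this
  rw [this]
  exact one_ne_zero

theorem inv_eq_of_mul_eq_one {f g : Series} (h : f * g = 1) : f⁻¹ = g := by
  have hf : MvPowerSeries.constantCoeff f ≠ 0 := fun h0 => by
    simpa [h0] using congrArg MvPowerSeries.constantCoeff h
  exact (MvPowerSeries.inv_eq_iff_mul_eq_one hf).2 (by rw [mul_comm, h])

theorem mul_inv_of_isUnit {f : Series} (h : IsUnit f) : f * f⁻¹ = 1 :=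
  MvPowerSeries.mul_inv_cancel f (MvPowerSeries.isUnit_iff_constantCoeff.1 h).ne_zero

theorem inv_sub_inv_mem {N : ℕ} {f g : Series} (h : f - g ∈ orderIdeal N) :
    f⁻¹ - g⁻¹ ∈ orderIdeal N := by
  rcases Nat.eq_zero_or_pos N with rfl | hN
  · simp [orderIdeal_zero]
  have h0 := constantCoeff_eq_zero_of_mem hN h
  rw [map_sub, sub_eq_zero] at h0
  -- For `N ≥ 1` the constant terms agree, so either both inverses are genuine or both are `0` by
  -- convention. The contraction therefore holds on all pairs.
  by_cases hf : MvPowerSeries.constantCoeff f = 0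
  · rw [MvPowerSeries.inv_eq_zero.2 hf, MvPowerSeries.inv_eq_zero.2 (h0 ▸ hf), sub_zero]
    exact Ideal.zero_mem _
  · have h1 := MvPowerSeries.mul_inv_cancel f hf
    have h2 := MvPowerSeries.mul_inv_cancel g (h0 ▸ hf)
    have : f⁻¹ - g⁻¹ = (-(f⁻¹ * g⁻¹)) * (f - g) := by
      linear_combination g⁻¹ * h1 - f⁻¹ * h2
    rw [this]
    exact Ideal.mul_mem_left _ _ h

/-- The map whose fixed points are the solutions of the system. -/
noncomputable def systemMap (p : Series × Series) : Series × Series :=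
  (((1 - p.2) ^ 2)⁻¹ * (y + z * p.1 * (1 - p.1)⁻¹),
    ((1 - p.1) ^ 2)⁻¹ * (x + z * p.2 * (1 - p.2)⁻¹))

theorem mk_eq {N : ℕ} {f g : Series} :
    Ideal.Quotient.mk (orderIdeal N) f = Ideal.Quotient.mk (orderIdeal N) g ↔
      f - g ∈ orderIdeal N := Ideal.Quotient.eq

/-- After expansion, each term has a factor `t` or `z`, and this gains one order. -/
theorem systemMap_component {N : ℕ} {A B A' B' t : Series} (ht : t ∈ orderIdeal 1)
    (hA : A - A' ∈ orderIdeal N) (hB : B - B' ∈ orderIdeal N) :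
    ((1 - B) ^ 2)⁻¹ * (t + z * A * (1 - A)⁻¹) - ((1 - B') ^ 2)⁻¹ * (t + z * A' * (1 - A')⁻¹) ∈
      orderIdeal (N + 1) := by
  have h1 : (1 - A)⁻¹ - (1 - A')⁻¹ ∈ orderIdeal N := inv_sub_inv_mem (by
    rw [← mk_eq] at *; simp only [map_sub, hA])
  have h2 : ((1 - B) ^ 2)⁻¹ - ((1 - B') ^ 2)⁻¹ ∈ orderIdeal N := inv_sub_inv_mem (by
    rw [← mk_eq] at *; simp only [map_sub, map_pow, hB])
  have h3 : ((1 - B) ^ 2)⁻¹ * A * (1 - A)⁻¹ - ((1 - B') ^ 2)⁻¹ * A' * (1 - A')⁻¹ ∈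
      orderIdeal N := by
    rw [← mk_eq] at *; simp only [map_mul, hA, h1, h2]
  have := add_mem (mul_mem_orderIdeal ht h2) (mul_mem_orderIdeal z_mem_orderIdeal h3)
  rw [add_comm 1 N] at this
  convert this using 1
  ring

theorem isContraction_systemMap : IsContraction systemMap := fun _ _ _ h =>
  ⟨systemMap_component y_mem_orderIdeal h.1 h.2, systemMap_component x_mem_orderIdeal h.2 h.1⟩

theorem isUnit_one_sub {f : Series} (h : f ∈ orderIdeal 1) : IsUnit (1 - f) := by
  rw [MvPowerSeries.isUnit_iff_constantCoeff, isUnit_iff_ne_zero]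
  exact constantCoeff_ne_zero (by simpa using h)

/-- Invertibility is automatic for a fixed point: its components are multiples of series of order at
least `1`. -/
theorem isCanopySystem_iff {A B : Series} : IsCanopySystem A B ↔ systemMap (A, B) = (A, B) := by
  refine ⟨fun h => Prod.ext h.2.2.1.symm h.2.2.2.symm, fun h => ?_⟩
  have hA : ((1 - B) ^ 2)⁻¹ * (y + z * A * (1 - A)⁻¹) = A := congrArg Prod.fst h
  have hB : ((1 - A) ^ 2)⁻¹ * (x + z * B * (1 - B)⁻¹) = B := congrArg Prod.snd h
  refine ⟨isUnit_one_sub ?_, isUnit_one_sub ?_, hA.symm, hB.symm⟩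
  · rw [← hA, mul_assoc z]
    exact Ideal.mul_mem_left _ _ (add_mem y_mem_orderIdeal (Ideal.mul_mem_right _ _ z_mem_orderIdeal))
  · rw [← hB, mul_assoc z]
    exact Ideal.mul_mem_left _ _ (add_mem x_mem_orderIdeal (Ideal.mul_mem_right _ _ z_mem_orderIdeal))

theorem existsUnique_isCanopySystem : ∃! P : Series × Series, IsCanopySystem P.1 P.2 := by
  obtain ⟨p, hp⟩ := isContraction_systemMap.exists_fixed
  refine ⟨p, isCanopySystem_iff.2 hp, fun q hq => ?_⟩
  have hq' : systemMap q = q := isCanopySystem_iff.1 hq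
  have h : ∀ N, CongMod N q p := fun N => isContraction_systemMap.congMod
    (by rw [hq']; exact .refl _ _) (by rw [hp]; exact .refl _ _)
  exact Prod.ext (eq_of_sub_mem fun N => (h N).1) (eq_of_sub_mem fun N => (h N).2)

/-! ### Kernel method and approximate solutions -/

theorem eval_mem_of_mem_map_C {I : Ideal Series} {p : Series[X]} (h : p ∈ I.map C) (u : Series) :
    p.eval u ∈ I := by
  rw [Ideal.mem_map_C_iff] at h
  rw [eval_eq_sum]
  exact Ideal.sum_mem _ fun n _ => Ideal.mul_mem_right _ _ (h n)

theorem derivative_mem_of_mem_map_C {I : Ideal Series} {p : Series[X]} (h : p ∈ I.map C) :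
    derivative p ∈ I.map C := by
  rw [Ideal.mem_map_C_iff] at h ⊢
  intro n
  rw [coeff_derivative]
  exact Ideal.mul_mem_right _ _ (h _)

theorem eval_sub_eval_mem {I : Ideal Series} (p : Series[X]) {u v : Series} (h : u - v ∈ I) :
    p.eval u - p.eval v ∈ I :=
  Ideal.mem_of_dvd _ (sub_dvd_eval_sub u v p) h

/-- Existence of the series at which the partial derivative of the functional equation with
respect to the unknown polynomial vanishes. -/
theorem exists_kernel (H : Series[X]) (h : Series) : ∃ V ∈ orderIdeal 1,
    V = (1 + V) * (V * (y - z) + x * (H.eval (1 + V) - h) + V * z * H.eval (1 + V) +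
      H.eval (1 + V) * (x + V * z)) := by
  -- `P`, `Q`, `R` collect the terms with factor `x`, `y`, `z`; these factors make the right-hand
  -- side a contraction in `V`.
  let K : Series[X] := H.comp (1 + X)
  let P : Series[X] := (1 + X) * (K - C h + K)
  let Q : Series[X] := (1 + X) * X
  let R : Series[X] := (1 + X) * (X * K - X + K * X)
  let Ψ : Series → Series := fun V => x * P.eval V + y * Q.eval V + z * R.eval V
  have hΨ : ∀ V, Ψ V = (1 + V) * (V * (y - z) + x * (H.eval (1 + V) - h) +
      V * z * H.eval (1 + V) + H.eval (1 + V) * (x + V * z)) := by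
    intro V
    simp only [Ψ, P, Q, R, K, eval_mul, eval_add, eval_sub, eval_comp, eval_one, eval_X, eval_C]
    ring
  have hc : IsContraction fun p => (Ψ p.1, 0) := by
    intro N p q hpq
    refine ⟨?_, by simp⟩
    have := add_mem (add_mem (mul_mem_orderIdeal x_mem_orderIdeal (eval_sub_eval_mem P hpq.1))
      (mul_mem_orderIdeal y_mem_orderIdeal (eval_sub_eval_mem Q hpq.1)))
      (mul_mem_orderIdeal z_mem_orderIdeal (eval_sub_eval_mem R hpq.1))
    rw [add_comm 1 N] at this
    convert this using 1
    simp only [Ψ]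
    ring
  obtain ⟨p, hp⟩ := hc.exists_fixed
  have hp1 : Ψ p.1 = p.1 := congrArg Prod.fst hp
  refine ⟨p.1, ?_, (hp1.symm.trans (hΨ _))⟩
  rw [← hp1]
  exact add_mem (add_mem (Ideal.mul_mem_right _ _ x_mem_orderIdeal)
    (Ideal.mul_mem_right _ _ y_mem_orderIdeal)) (Ideal.mul_mem_right _ _ z_mem_orderIdeal)

/-- The right-hand side of the formula for `intervalSeries`. -/
noncomputable def canopyFormula (p : Series × Series) : Series :=
  x * p.1 * (1 - p.1)⁻¹ + y * p.2 * (1 - p.2)⁻¹ +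
    z * p.1 * p.2 * ((1 - p.1) * (1 - p.2))⁻¹ - p.1 * p.2

theorem canopyFormula_sub_mem {N : ℕ} {p q : Series × Series} (h : CongMod N p q) :
    canopyFormula p - canopyFormula q ∈ orderIdeal N := by
  obtain ⟨hA, hB⟩ := h
  have h1 : (1 - p.1)⁻¹ - (1 - q.1)⁻¹ ∈ orderIdeal N := inv_sub_inv_mem (by
    rw [← mk_eq] at *; simp only [map_sub, hA])
  have h2 : (1 - p.2)⁻¹ - (1 - q.2)⁻¹ ∈ orderIdeal N := inv_sub_inv_mem (by
    rw [← mk_eq] at *; simp only [map_sub, hB])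
  rw [canopyFormula, canopyFormula, MvPowerSeries.mul_inv_rev, MvPowerSeries.mul_inv_rev]
  rw [← mk_eq] at *
  simp only [map_sub, map_add, map_mul, hA, hB, h1, h2]

theorem truncPoly_sub_one_mem (N : ℕ) : truncPoly N - 1 ∈ (orderIdeal 1).map C := by
  rw [truncPoly, Finset.sum_range_succ', sizePoly_zero, add_sub_cancel_right]
  exact Ideal.sum_mem _ fun n _ => Ideal.map_mono (orderIdeal_anti (by omega)) (sizePoly_mem (n + 1))

/-- The functional equation and its derivative, evaluated at the kernel root, are rewritten in `A`
and `B`; all errors are multiples of the errors `E1`, `E2` of these two equations. -/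
theorem exists_approximate_solution (N : ℕ) : ∃ p : Series × Series,
    CongMod (N + 1) (systemMap p) p ∧
      canopyFormula p - x * ((truncPoly N).eval 1 - 1) ∈ orderIdeal (N + 1) := by
  set H := truncPoly N with hH
  set h := H.eval 1 with hh
  obtain ⟨V, hV, hK⟩ := exists_kernel H h
  set W := H.eval (1 + V) with hW
  have hU1 : (1 + V) * (1 + V)⁻¹ = 1 :=
    MvPowerSeries.mul_inv_cancel _ (constantCoeff_ne_zero (by simpa using hV))
  have hW1 : W * W⁻¹ = 1 := MvPowerSeries.mul_inv_cancel _ (constantCoeff_ne_zero (by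
    simpa using eval_mem_of_mem_map_C (truncPoly_sub_one_mem N) (1 + V)))
  set s := (1 + V)⁻¹
  set w := W⁻¹
  have hE := truncPoly_functional N
  have e1 := eval_mem_of_mem_map_C hE (1 + V)
  have e2 := eval_mem_of_mem_map_C (derivative_mem_of_mem_map_C hE) (1 + V)
  simp only [← hH, ← hh, ← hW, derivative_mul, derivative_add, derivative_sub, derivative_X,
    derivative_C, derivative_one, eval_add, eval_sub, eval_mul, eval_X, eval_C, eval_one,
    eval_zero] at e1 e2
  set W' := (derivative H).eval (1 + V)
  set E1 := (1 + V) * W * (V * (y - z) + x * (W - h) + V * z * W) - V * (W - 1) with hE1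
  have e1' : E1 ∈ orderIdeal (N + 1) := by
    convert e1 using 1
    ring
  have e2' : W * (V * (y - z) + x * (W - h) + V * z * W) + (1 + V) * W * (y - z + z * W) -
      (W - 1) ∈ orderIdeal (N + 1) := by
    -- The coefficient of `W'` is the derivative of the equation in the unknown, which vanishes by
    -- the choice of `V`.
    convert e2 using 1
    linear_combination W' * hK
  set E2 := W * (V * (y - z) + x * (W - h) + V * z * W) + (1 + V) * W * (y - z + z * W) -
      (W - 1) with hE2
  have hA : (1 - (1 - w))⁻¹ = W := inv_eq_of_mul_eq_one (by linear_combination hW1)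
  have hB : (1 - V * s)⁻¹ = 1 + V := inv_eq_of_mul_eq_one (by
    linear_combination (-V) * hU1)
  have hA2 : ((1 - (1 - w)) ^ 2)⁻¹ = W ^ 2 := by rw [sq, MvPowerSeries.mul_inv_rev, hA, sq]
  have hB2 : ((1 - V * s) ^ 2)⁻¹ = (1 + V) ^ 2 := by rw [sq, MvPowerSeries.mul_inv_rev, hB, sq]
  -- This choice makes `1/(1 - A) = W` and `1/(1 - B) = 1 + V`.
  refine ⟨(1 - w, V * s), ⟨?_, ?_⟩, ?_⟩
  · simp only [systemMap, hA, hB2]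
    have : (1 + V) ^ 2 * (y + z * (1 - w) * W) - (1 - w) = w * ((1 + V) * E2 - E1) := by
      linear_combination (1 - (1 + V) ^ 2 * z - (1 + V) ^ 2 * (y - z + z * W)) * hW1
    rw [this]
    exact Ideal.mul_mem_left _ _ (sub_mem (Ideal.mul_mem_left _ _ e2') e1')
  · simp only [systemMap, hB, hA2]
    have : W ^ 2 * (x + z * (V * s) * (1 + V)) - V * s = -s * E1 := by
      linear_combination (-W ^ 2 * x) * hU1 - s * W * hK
    rw [this]
    exact Ideal.mul_mem_left _ _ e1'
  · simp only [canopyFormula, MvPowerSeries.mul_inv_rev, hA, hB]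
    have : x * (1 - w) * W + y * (V * s) * (1 + V) + z * (1 - w) * (V * s) * ((1 + V) * W) -
        (1 - w) * (V * s) - x * (h - 1) = s * w * E1 := by
      linear_combination
        (s * V - x - z * V - (V * (y - z) + x * (W - h) + V * z * W)) * hW1 +
        (y * V + z * V * (W - w * W) - (V * (y - z) + x * (W - h) + V * z * W) * w * W) * hU1
    rw [this]
    exact Ideal.mul_mem_left _ _ e1'

theorem intervalSeries_eq {A B : Series} (h : IsCanopySystem A B) :
    intervalSeries = canopyFormula (A, B) := by
  refine eq_of_sub_mem fun N => orderIdeal_anti (Nat.le_succ N) ?_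
  obtain ⟨p, hp, hf⟩ := exists_approximate_solution N
  have hAB : CongMod (N + 1) p (A, B) := isContraction_systemMap.congMod hp
    (by rw [isCanopySystem_iff.1 h]; exact .refl _ _)
  have := add_mem (sub_mem (intervalSeries_sub_mem N) hf) (canopyFormula_sub_mem hAB)
  convert this using 1
  ring

/-! ### The marked series via the Euler operator -/

/-- The Euler operator `x ∂/∂x + y ∂/∂y + z ∂/∂z`. -/
noncomputable def euler (f : Series) : Series :=
  fun d => (d.degree : ℚ) * MvPowerSeries.coeff d f

theorem coeff_euler (d : Fin 3 →₀ ℕ) (f : Series) :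
    MvPowerSeries.coeff d (euler f) = (d.degree : ℚ) * MvPowerSeries.coeff d f := rfl

theorem euler_add (f g : Series) : euler (f + g) = euler f + euler g := by
  ext d; simp only [coeff_euler, map_add, mul_add]

theorem euler_sub (f g : Series) : euler (f - g) = euler f - euler g := by
  ext d; simp only [coeff_euler, map_sub, mul_sub]

theorem euler_mul (f g : Series) : euler (f * g) = euler f * g + f * euler g := by
  ext d
  simp only [coeff_euler, map_add, MvPowerSeries.coeff_mul, Finset.mul_sum,
    ← Finset.sum_add_distrib]
  refine Finset.sum_congr rfl fun p hp => ?_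
  rw [Finset.HasAntidiagonal.mem_antidiagonal] at hp
  rw [← hp, map_add, Nat.cast_add]
  ring

theorem euler_one : euler 1 = 0 := by
  ext d
  rw [coeff_euler, MvPowerSeries.coeff_one]
  split_ifs with h <;> simp [h]

theorem euler_X (i : Fin 3) : euler (MvPowerSeries.X i) = MvPowerSeries.X i := by
  ext d
  rw [coeff_euler, MvPowerSeries.coeff_X]
  split_ifs with h <;> simp [h]

theorem euler_inv_one_sub {f g : Series} (h : (1 - f) * g = 1) : euler g = g ^ 2 * euler f := by
  have h1 := congrArg euler h
  rw [euler_mul, euler_sub, euler_one] at h1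
  linear_combination g * h1 - euler g * h

theorem markedIntervalSeries_eq : markedIntervalSeries = euler intervalSeries - intervalSeries := by
  ext d
  rw [coeff_markedIntervalSeries, map_sub, coeff_euler, coeff_intervalSeries, degree_eq]
  push_cast
  ring

/-- The partial derivative of `canopyFormula` in `A` vanishes by the equation for `B`, and the one
in `B` by the equation for `A`. So the Euler operator acts only on the explicit `x`, `y`, `z`, in
which the formula is linear apart from `-A * B`; it returns the formula plus `A * B`. -/
theorem markedIntervalSeries_eq_mul {A B : Series} (h : IsCanopySystem A B) :
    markedIntervalSeries = A * B := by
  have hF := intervalSeries_eq h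
  obtain ⟨hA, hB, hA', hB'⟩ := h
  have ha := mul_inv_of_isUnit hA
  have hb := mul_inv_of_isUnit hB
  rw [canopyFormula, MvPowerSeries.mul_inv_rev] at hF
  rw [sq, MvPowerSeries.mul_inv_rev] at hA' hB'
  dsimp only at hF
  set a := (1 - A)⁻¹
  set b := (1 - B)⁻¹
  have hx : euler x = x := euler_X 0
  have hy : euler y = y := euler_X 1
  have hz : euler z = z := euler_X 2
  rw [markedIntervalSeries_eq, hF]
  simp only [euler_sub, euler_add, euler_mul, euler_inv_one_sub ha, euler_inv_one_sub hb, hx, hy,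
    hz]
  linear_combination (-(x * a + z * B * b * a) * euler A) * ha - euler A * hB' -
    (y * b + z * A * a * b) * euler B * hb - euler B * hA'

end TamariCanopy

/-- The system has a unique solution `(A, B)`, and the two canopy series of Tamari intervals
are given in terms of it. -/
theorem mainTheorem6 :
    (∃! P : TamariCanopy.Series × TamariCanopy.Series, TamariCanopy.IsCanopySystem P.1 P.2) ∧
    ∀ A B : TamariCanopy.Series, TamariCanopy.IsCanopySystem A B →
      TamariCanopy.markedIntervalSeries = A * B ∧
      TamariCanopy.intervalSeries =
        TamariCanopy.x * A * (1 - A)⁻¹ + TamariCanopy.y * B * (1 - B)⁻¹ +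
          TamariCanopy.z * A * B * ((1 - A) * (1 - B))⁻¹ - A * B :=
  ⟨TamariCanopy.existsUnique_isCanopySystem, fun _ _ h =>
    ⟨TamariCanopy.markedIntervalSeries_eq_mul h, TamariCanopy.intervalSeries_eq h⟩⟩
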